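/- For $t\in\mathbb R$ let $((t))=t-\lfloor t\rfloor-1/2$ if $t\notin\mathbb Z$ and $((t))=0$ if $t\in\mathbb Z$. For a positive integer $n$ and $m\in\mathbb Z$ with $(m,n)=1$ let $S(m,n)=12\sum_{k=1}^n((k/n))((mk/n))$ be the normalized Dedekind sum. Call an equality $S(m_1,n)=S(m_2,n)$ non-obvious if $m_1\not\equiv m_2$ and $m_1m_2\not\equiv 1$ mod $n$. Let $p$ be a prime number. For every $\varepsilon\in\{\pm1\}$ all values $S(\varepsilon+pm,p^2)$, $m=1,\dots,p-1$, are equal, namely $$S(\varepsilon+pm,p^2)=\varepsilon\left(\frac 2{p^2}-2\right).$$ If $p\ge 5$, then for each $\varepsilon\in\{\pm1\}$ the set $M_\varepsilon=\{\varepsilon+pm : m=1,\dots,(p-1)/2\}$ has at least two elements, and $S(a,p^2)=S(b,p^2)$ is a non-obvious equality for all $a,b\in M_\varepsilon$, $a\ne b$. All non-obvious equalities $S(m_1,p^2)=S(m_2,p^2)$ with integers $m_1,m_2$ not divisible by $p$ arise from these by transition to multiplicative inverses mod $p^2$: if $S(m_1,p^2)=S(m_2,p^2)$ is non-obvious and $p\nmid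 m_1,m_2$, then $p\ge5$ and there are $\varepsilon\in\{\pm1\}$ and $a,b\in M_\varepsilon$, $a\neq b$, such that, mod $p^2$, $m_1$ is congruent to $a$ or to an inverse of $a$, and $m_2$ is congruent to $b$ or to an inverse of $b$. -/

import Mathlib

noncomputable section

open Classical in
/-- The sawtooth function `((t))`: `t - ⌊t⌋ - 1/2` for non-integral real `t`, and `0` for
integral `t`. -/
def sawtooth (t : ℝ) : ℝ :=
  if t ∈ Set.range ((↑) : ℤ → ℝ) then 0 else t - (⌊t⌋ : ℝ) - 1 / 2

/-- The classical Dedekind sum `s(m, n) = ∑_{k=1}^{n} ((k/n)) ((mk/n))`. -/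
def dedekindSum (m : ℤ) (n : ℕ) : ℝ :=
  ∑ k ∈ Finset.Icc 1 n, sawtooth ((k : ℝ) / (n : ℝ)) * sawtooth ((m : ℝ) * (k : ℝ) / (n : ℝ))

/-- The normalized Dedekind sum `S(m, n) = 12 s(m, n)`. -/
def normDedekindSum (m : ℤ) (n : ℕ) : ℝ :=
  12 * dedekindSum m n

/-- The equality `S(m₁, n) = S(m₂, n)` holds and is non-obvious: `m₁` and `m₂` are neither
congruent nor multiplicative inverses of each other modulo `n`. -/
def NonObviousEq (n : ℕ) (m₁ m₂ : ℤ) : Prop :=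
  normDedekindSum m₁ n = normDedekindSum m₂ n ∧
    ¬ m₁ ≡ m₂ [ZMOD n] ∧ ¬ m₁ * m₂ ≡ 1 [ZMOD n]

/-- `m` is congruent modulo `n` to `a` or to a multiplicative inverse of `a`. -/
def EqOrInverse (n : ℕ) (m a : ℤ) : Prop :=
  m ≡ a [ZMOD n] ∨ m * a ≡ 1 [ZMOD n]

/-- The set `{ε + p m ; m = 1, …, (p - 1) / 2}` (empty for `p = 2`). -/
def halfSeries (p : ℕ) (ε : ℤ) : Set ℤ :=
  {a | ∃ m : ℕ, 1 ≤ m ∧ 2 * m ≤ p - 1 ∧ a = ε + (p : ℤ) * (m : ℤ)}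

end

/-! For `m` coprime to `n`, `N = n S(m, n)` is an integer with `m N ≡ m² + 1` mod `n`. Equal sums
share `N`, so eliminating it gives `n ∣ (m₁ - m₂)(m₁ m₂ - 1)` (`dvd_of_normDedekindSum_eq`). For `n
= p²` a non-obvious equality forces `p` to divide both factors, so `m₁ ≡ m₂ ≡ ε = ±1` mod `p`.

On these classes the sums are explicit: `S(ε + p a, p²)` has one value for all `a` prime to `p`
(`normDedekindSum_unit_add_mul`) and another for `p ∣ a`. Since `ε + p a` and `ε - p a` are inverse
mod `p²`, the `a` in `1, …, (p - 1) / 2` represent the remaining residues up to inversion. -/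

lemma sawtooth_neg (t : ℝ) : sawtooth (-t) = -sawtooth t := by
  unfold sawtooth
  by_cases h : t ∈ Set.range ((↑) : ℤ → ℝ)
  · have h' : -t ∈ Set.range ((↑) : ℤ → ℝ) := by
      obtain ⟨z, rfl⟩ := h
      exact ⟨-z, by push_cast; rfl⟩
    simp only [if_pos h, if_pos h', neg_zero]
  · have h' : -t ∉ Set.range ((↑) : ℤ → ℝ) := by
      rintro ⟨z, hz⟩
      exact h ⟨-z, by push_cast; linarith⟩
    have h1 : (⌊t⌋ : ℝ) ≠ t := fun e => h ⟨_, e⟩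
    have h2 : ⌊-t⌋ = -⌊t⌋ - 1 := by
      rw [Int.floor_eq_iff]
      push_cast
      have := lt_of_le_of_ne (Int.floor_le t) h1
      have := Int.lt_floor_add_one t
      constructor <;> linarith
    rw [if_neg h, if_neg h', h2]
    push_cast
    ring

lemma sawtooth_int_div_of_dvd {n : ℕ} (hn : 0 < n) {a : ℤ} (h : (n : ℤ) ∣ a) :
    sawtooth ((a : ℝ) / n) = 0 := by
  obtain ⟨c, rfl⟩ := h
  have hn' : (n : ℝ) ≠ 0 := by positivity
  exact if_pos ⟨c, by push_cast; field_simp⟩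

lemma sawtooth_int_div_of_not_dvd {n : ℕ} (hn : 0 < n) {a : ℤ} (h : ¬ (n : ℤ) ∣ a) :
    sawtooth ((a : ℝ) / n) = ((a % n : ℤ) : ℝ) / n - 1 / 2 := by
  have hn' : (n : ℝ) ≠ 0 := by positivity
  have h1 : (a : ℝ) / n ∉ Set.range ((↑) : ℤ → ℝ) := by
    rintro ⟨z, hz⟩
    rw [eq_div_iff hn'] at hz
    exact h ⟨z, by rw [mul_comm]; exact_mod_cast hz.symm⟩
  have hfl : ⌊(a : ℝ) / n⌋ = a / n := by
    rw [Int.floor_eq_iff, le_div_iff₀ (by positivity), div_lt_iff₀ (by positivity)]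
    have hn'' : (0 : ℤ) < n := by exact_mod_cast hn
    constructor
    · exact_mod_cast Int.ediv_mul_le a hn''.ne'
    · exact_mod_cast Int.lt_ediv_add_one_mul_self a hn''
  have h2 : (a : ℝ) = n * ((a / n : ℤ) : ℝ) + ((a % n : ℤ) : ℝ) := by
    exact_mod_cast (Int.mul_ediv_add_emod a n).symm
  unfold sawtooth
  rw [if_neg h1, hfl]
  nth_rewrite 1 [h2]
  field_simp
  ring

lemma normDedekindSum_neg (m : ℤ) (n : ℕ) : normDedekindSum (-m) n = -normDedekindSum m n := by
  unfold normDedekindSum dedekindSum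
  rw [← mul_neg, ← Finset.sum_neg_distrib]
  congr 1
  refine Finset.sum_congr rfl fun k _ => ?_
  rw [← mul_neg, ← sawtooth_neg]
  push_cast
  ring_nf

/-- An affine map with invertible slope permutes the residues modulo `n`. -/
lemma sum_range_affine_emod {n : ℕ} (hn : 0 < n) {a : ℤ} (ha : IsCoprime a (n : ℤ)) (b : ℤ)
    (f : ℤ → ℝ) :
    ∑ k ∈ Finset.range n, f ((a * k + b) % n) = ∑ k ∈ Finset.range n, f k := by
  have hn' : (0 : ℤ) < n := by exact_mod_cast hn
  have h0 : ∀ z : ℤ, 0 ≤ z % n := fun z => Int.emod_nonneg _ hn'.ne'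
  have h1 : ∀ z : ℤ, z % n < n := fun z => Int.emod_lt_of_pos _ hn'
  have hmaps : ∀ k ∈ Finset.range n, ((a * k + b) % n).toNat ∈ Finset.range n := by
    intro k _
    rw [Finset.mem_range]
    have := h0 (a * k + b)
    have := h1 (a * k + b)
    omega
  have hinj : Set.InjOn (fun k : ℕ => ((a * k + b) % n).toNat) (Finset.range n) := by
    intro x hx y hy hxy
    simp only [Finset.coe_range, Set.mem_Iio] at hx hy
    have e : (a * x + b) % n = (a * y + b) % n := by
      have := h0 (a * x + b)
      have := h0 (a * y + b)
      simp only at hxy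
      omega
    have d := Int.ModEq.dvd (show a * x + b ≡ a * y + b [ZMOD n] from e)
    rw [show a * y + b - (a * x + b) = a * ((y : ℤ) - x) by ring] at d
    have d' := ha.symm.dvd_of_dvd_mul_left d
    have := Int.eq_zero_of_abs_lt_dvd d' (by rw [abs_lt]; omega)
    omega
  refine Finset.sum_nbij (fun k : ℕ => ((a * k + b) % n).toNat) hmaps hinj
    (Finset.surjOn_of_injOn_of_card_le _ hmaps hinj le_rfl) fun k _ => ?_
  rw [Int.toNat_of_nonneg (h0 _)]

lemma sum_range_mul_emod {n : ℕ} (hn : 0 < n) {a : ℤ} (ha : IsCoprime a (n : ℤ)) (f : ℤ → ℝ) :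
    ∑ k ∈ Finset.range n, f (a * k % n) = ∑ k ∈ Finset.range n, f k := by
  simpa using sum_range_affine_emod hn ha 0 f

lemma sum_range_cast_real (n : ℕ) :
    ∑ k ∈ Finset.range n, (k : ℝ) = (n : ℝ) * (n - 1) / 2 := by
  induction n with
  | zero => simp
  | succ n ih => rw [Finset.sum_range_succ, ih]; push_cast; ring

lemma sum_range_sq_cast_real (n : ℕ) :
    ∑ k ∈ Finset.range n, (k : ℝ) ^ 2 = (n : ℝ) * (n - 1) * (2 * n - 1) / 6 := by
  induction n with
  | zero => simp
  | succ n ih => rw [Finset.sum_range_succ, ih]; push_cast; ring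

/-! ### Sums over residues and the congruence they force -/

/-- The residue `0` contributes `(-1/2)² = 1/4` on the right, whereas the sawtooth vanishes at
integers; hence the correction. -/
lemma dedekindSum_eq_sum_residues {n : ℕ} (hn : 0 < n) {m : ℤ} (hm : IsCoprime m (n : ℤ)) :
    dedekindSum m n = ∑ k ∈ Finset.range n,
      ((k : ℝ) / n - 1 / 2) * (((m * k % n : ℤ) : ℝ) / n - 1 / 2) - 1 / 4 := by
  have hI : Finset.Icc 1 n = insert n (Finset.Ico 1 n) := by
    ext k
    simp only [Finset.mem_Icc, Finset.mem_insert, Finset.mem_Ico]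
    omega
  have hR : Finset.range n = insert 0 (Finset.Ico 1 n) := by
    ext k
    simp only [Finset.mem_range, Finset.mem_insert, Finset.mem_Ico]
    omega
  have hlast : sawtooth ((n : ℝ) / n) = 0 := by
    simpa using sawtooth_int_div_of_dvd hn (dvd_refl (n : ℤ))
  unfold dedekindSum
  rw [hI, hR, Finset.sum_insert (by simp), Finset.sum_insert (by simp), hlast]
  have : ∑ k ∈ Finset.Ico 1 n, sawtooth ((k : ℝ) / n) * sawtooth ((m : ℝ) * k / n) =
      ∑ k ∈ Finset.Ico 1 n, ((k : ℝ) / n - 1 / 2) * (((m * k % n : ℤ) : ℝ) / n - 1 / 2) := by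
    refine Finset.sum_congr rfl fun k hk => ?_
    rw [Finset.mem_Ico] at hk
    have hk' : ¬ (n : ℤ) ∣ k := by
      intro h
      have := Nat.le_of_dvd (by omega) (Int.natCast_dvd_natCast.mp h)
      omega
    have hmk : ¬ (n : ℤ) ∣ m * k := fun h => hk' (hm.symm.dvd_of_dvd_mul_left h)
    have e1 := sawtooth_int_div_of_not_dvd hn hk'
    have e2 := sawtooth_int_div_of_not_dvd hn hmk
    rw [Int.emod_eq_of_lt (by omega) (by omega)] at e1
    push_cast at e1 e2
    rw [e1, e2]
  rw [this]
  norm_num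

lemma mul_normDedekindSum {n : ℕ} (hn : 0 < n) {m : ℤ} (hm : IsCoprime m (n : ℤ)) :
    (n : ℝ) * normDedekindSum m n =
      12 / n * ∑ k ∈ Finset.range n, (k : ℝ) * ((m * k % n : ℤ) : ℝ) - 3 * n * (n - 1) := by
  have hn' : (n : ℝ) ≠ 0 := by positivity
  have hr := sum_range_mul_emod hn hm (fun z => (z : ℝ))
  simp only [Int.cast_natCast] at hr
  have hk := sum_range_cast_real n
  rw [hk] at hr
  have : ∑ k ∈ Finset.range n, ((k : ℝ) / n - 1 / 2) * (((m * k % n : ℤ) : ℝ) / n - 1 / 2) =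
      (∑ k ∈ Finset.range n, (k : ℝ) * ((m * k % n : ℤ) : ℝ)) / n ^ 2
      - (∑ k ∈ Finset.range n, (k : ℝ)) / (2 * n)
      - (∑ k ∈ Finset.range n, ((m * k % n : ℤ) : ℝ)) / (2 * n) + n / 4 := by
    have hc : (n : ℝ) / 4 = ∑ k ∈ Finset.range n, (1 / 4 : ℝ) := by
      rw [Finset.sum_const, Finset.card_range, nsmul_eq_mul]; ring
    rw [hc, Finset.sum_div, Finset.sum_div, Finset.sum_div, ← Finset.sum_sub_distrib,
      ← Finset.sum_sub_distrib, ← Finset.sum_add_distrib]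
    refine Finset.sum_congr rfl fun k _ => ?_
    field_simp
    ring
  rw [normDedekindSum, dedekindSum_eq_sum_residues hn hm, this, hr, hk]
  field_simp
  ring

lemma normDedekindSum_congr {n : ℕ} (hn : 0 < n) {m m' : ℤ} (hm : IsCoprime m (n : ℤ))
    (h : m ≡ m' [ZMOD n]) : normDedekindSum m n = normDedekindSum m' n := by
  have hn' : (n : ℝ) ≠ 0 := by positivity
  have hm' : IsCoprime m' (n : ℤ) := by
    obtain ⟨c, hc⟩ := h.dvd
    rw [show m' = m + c * n by linear_combination hc]
    exact hm.add_mul_right_left c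
  refine mul_left_cancel₀ hn' ?_
  rw [mul_normDedekindSum hn hm, mul_normDedekindSum hn hm']
  have : ∀ k : ℕ, m * k % n = m' * k % n := fun k => h.mul_right _
  simp only [this]

/-- `n S(m, n)` is an integer `N` with `m N ≡ m² + 1` modulo `n`. -/
lemma exists_int_eq_mul_normDedekindSum {n : ℕ} (hn : 0 < n) {m : ℤ}
    (hm : IsCoprime m (n : ℤ)) :
    ∃ N : ℤ, (n : ℝ) * normDedekindSum m n = N ∧ (n : ℤ) ∣ m * N - (m ^ 2 + 1) := by
  have hn' : (n : ℝ) ≠ 0 := by positivity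
  have hmod : ∀ k : ℕ, ((m * k % n : ℤ) : ℝ) = m * k - n * ((m * k / n : ℤ) : ℝ) := fun k => by
    exact_mod_cast Int.emod_def (m * k) n
  have hsq := sum_range_sq_cast_real n
  have hrsq := sum_range_mul_emod hn hm (fun z => (z : ℝ) ^ 2)
  simp only [Int.cast_natCast] at hrsq
  rw [hsq] at hrsq
  set T : ℝ := ∑ k ∈ Finset.range n, (k : ℝ) * ((m * k % n : ℤ) : ℝ) with hT
  have h1 : T = m * ∑ k ∈ Finset.range n, (k : ℝ) ^ 2
      - n * ∑ k ∈ Finset.range n, (k : ℝ) * ((m * k / n : ℤ) : ℝ) := by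
    rw [hT, Finset.mul_sum, Finset.mul_sum, ← Finset.sum_sub_distrib]
    refine Finset.sum_congr rfl fun k _ => ?_
    rw [hmod]
    ring
  -- With `r = mk mod n` and `q = ⌊mk/n⌋`, squaring `nq = mk - r` gives `2mkr = (mk)² + r² - n²q²`.
  -- The `r` permute the residues, so `∑ r² = ∑ k²`; this produces the factor `m² + 1`.
  have h2 : 2 * m * T = m ^ 2 * ∑ k ∈ Finset.range n, (k : ℝ) ^ 2
      + ∑ k ∈ Finset.range n, ((m * k % n : ℤ) : ℝ) ^ 2
      - n ^ 2 * ∑ k ∈ Finset.range n, ((m * k / n : ℤ) : ℝ) ^ 2 := by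
    rw [hT, Finset.mul_sum, Finset.mul_sum, Finset.mul_sum, ← Finset.sum_add_distrib,
      ← Finset.sum_sub_distrib]
    refine Finset.sum_congr rfl fun k _ => ?_
    rw [hmod]
    ring
  rw [hsq] at h1
  rw [hsq, hrsq] at h2
  have hS := mul_normDedekindSum hn hm
  rw [← hT] at hS
  set Q : ℤ := ∑ k ∈ Finset.range n, (k : ℤ) * (m * k / n)
  set R : ℤ := ∑ k ∈ Finset.range n, (m * k / n) ^ 2
  have hQ : (Q : ℝ) = ∑ k ∈ Finset.range n, (k : ℝ) * ((m * k / n : ℤ) : ℝ) := by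
    simp [Q]
  have hR : (R : ℝ) = ∑ k ∈ Finset.range n, ((m * k / n : ℤ) : ℝ) ^ 2 := by
    simp [R]
  rw [← hQ] at h1
  rw [← hR] at h2
  refine ⟨2 * m * (n - 1) * (2 * n - 1) - 12 * Q - 3 * n * (n - 1), ?_, ?_⟩
  · rw [hS, h1]
    push_cast
    field_simp
    ring
  · have e : (m : ℝ) * (2 * m * (n - 1) * (2 * n - 1) - 12 * Q - 3 * n * (n - 1)) =
        (m ^ 2 + 1) * (n - 1) * (2 * n - 1) - 6 * n * R - 3 * m * n * (n - 1) := by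
      refine mul_left_cancel₀ hn' ?_
      linear_combination 6 * h2 - 12 * (m : ℝ) * h1
    have e' : m * (2 * m * (n - 1) * (2 * n - 1) - 12 * Q - 3 * n * (n - 1)) =
        (m ^ 2 + 1) * (n - 1) * (2 * n - 1) - 6 * n * R - 3 * m * n * (n - 1) := by
      exact_mod_cast e
    -- Here `(n - 1)(2n - 1) = 1 + n(2n - 3)`.
    exact ⟨(m ^ 2 + 1) * (2 * n - 3) - 6 * R - 3 * m * (n - 1), by rw [e']; ring⟩

lemma dvd_of_normDedekindSum_eq {n : ℕ} (hn : 0 < n) {m₁ m₂ : ℤ} (h₁ : IsCoprime m₁ (n : ℤ))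
    (h₂ : IsCoprime m₂ (n : ℤ)) (h : normDedekindSum m₁ n = normDedekindSum m₂ n) :
    (n : ℤ) ∣ (m₁ - m₂) * (m₁ * m₂ - 1) := by
  obtain ⟨N, hN, d₁⟩ := exists_int_eq_mul_normDedekindSum hn h₁
  obtain ⟨N', hN', d₂⟩ := exists_int_eq_mul_normDedekindSum hn h₂
  obtain rfl : N = N' := by
    rw [h, hN'] at hN
    exact_mod_cast hN.symm
  rw [show (m₁ - m₂) * (m₁ * m₂ - 1) =
    m₁ * (m₂ * N - (m₂ ^ 2 + 1)) - m₂ * (m₁ * N - (m₁ ^ 2 + 1)) by ring]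
  exact (d₂.mul_left m₁).sub (d₁.mul_left m₂)

lemma normDedekindSum_one {n : ℕ} (hn : 0 < n) : normDedekindSum 1 n = n - 3 + 2 / n := by
  have hn' : (n : ℝ) ≠ 0 := by positivity
  have h := mul_normDedekindSum hn (isCoprime_one_left (x := (n : ℤ)))
  have : ∑ k ∈ Finset.range n, (k : ℝ) * ((1 * k % n : ℤ) : ℝ) =
      ∑ k ∈ Finset.range n, (k : ℝ) ^ 2 := by
    refine Finset.sum_congr rfl fun k hk => ?_
    rw [Finset.mem_range] at hk
    rw [one_mul, Int.emod_eq_of_lt (by omega) (by omega)]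
    push_cast
    ring
  rw [this, sum_range_sq_cast_real] at h
  refine mul_left_cancel₀ hn' ?_
  rw [h]
  field_simp
  ring

/-! ### Evaluation at `±1 + p a` modulo `p²` -/

lemma sum_range_mul_eq_sum_sum {M : Type*} [AddCommMonoid M] (f : ℕ → M) (p q : ℕ) :
    ∑ k ∈ Finset.range (p * q), f k =
      ∑ j ∈ Finset.range q, ∑ r ∈ Finset.range p, f (p * j + r) := by
  induction q with
  | zero => simp
  | succ q ih => rw [Nat.mul_succ, Finset.sum_range_add, ih, Finset.sum_range_succ]

lemma isCoprime_add_mul_sq {p : ℕ} {ε : ℤ} (hε : ε = 1 ∨ ε = -1) (a : ℤ) :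
    IsCoprime (ε + p * a) ((p ^ 2 : ℕ) : ℤ) := by
  push_cast
  refine IsCoprime.pow_right ⟨ε, -ε * a, ?_⟩
  rcases hε with rfl | rfl <;> ring

/-- Writing `k = p j + r`, the residue of `(1 + p a) k` is `r + p s` with `s = (a r + j) mod p`. For
fixed `j` or fixed `r`, `s` runs over all residues mod `p`, so every cross sum is independent of
`a`. -/
lemma normDedekindSum_one_add_mul {p : ℕ} (hp : p.Prime) {a : ℤ} (ha : ¬ (p : ℤ) ∣ a) :
    normDedekindSum (1 + p * a) (p ^ 2) = 2 / (p : ℝ) ^ 2 - 2 := by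
  have hp0 : 0 < p := hp.pos
  have hp0' : (0 : ℤ) < p := by exact_mod_cast hp0
  have hpr : (p : ℝ) ≠ 0 := by positivity
  have hco : IsCoprime a (p : ℤ) :=
    ((Nat.prime_iff_prime_int.mp hp).coprime_iff_not_dvd.mpr ha).symm
  have h := mul_normDedekindSum (pow_pos hp0 2) (isCoprime_add_mul_sq (p := p) (Or.inl rfl) a)
  have hres : ∀ j r : ℕ, r < p →
      (1 + (p : ℤ) * a) * ((p * j + r : ℕ) : ℤ) % ((p ^ 2 : ℕ) : ℤ) =
        r + p * ((a * r + j) % p) := by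
    intro j r hr
    have b0 := Int.emod_nonneg (a * r + j) hp0'.ne'
    have b1 := Int.emod_lt_of_pos (a * r + j) hp0'
    have hd := Int.emod_add_mul_ediv (a * r + j) p
    set s := (a * r + j) % p
    set t := (a * r + j) / p
    have e : (1 + (p : ℤ) * a) * ((p * j + r : ℕ) : ℤ) =
        (r + p * s) + ((p ^ 2 : ℕ) : ℤ) * (t + a * j) := by
      push_cast
      linear_combination -(p : ℤ) * hd
    rw [e, Int.add_mul_emod_self_left]
    refine Int.emod_eq_of_lt (by positivity) ?_
    push_cast
    have : (p : ℤ) * s ≤ p * (p - 1) := by gcongr; omega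
    nlinarith
  have hs1 : ∀ j : ℕ, ∑ r ∈ Finset.range p, (((a * r + j) % p : ℤ) : ℝ) = p * (p - 1) / 2 := by
    intro j
    have := sum_range_affine_emod hp0 hco j (fun z => (z : ℝ))
    simp only [Int.cast_natCast] at this
    rw [this, sum_range_cast_real]
  have hs2 : ∀ r : ℕ, ∑ j ∈ Finset.range p, (((a * r + j) % p : ℤ) : ℝ) = p * (p - 1) / 2 := by
    intro r
    have := sum_range_affine_emod hp0 isCoprime_one_left (a * r) (fun z => (z : ℝ))
    simp only [Int.cast_natCast, one_mul] at this
    rw [← sum_range_cast_real, ← this]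
    refine Finset.sum_congr rfl fun j _ => ?_
    rw [add_comm]
  have hsum : ∑ k ∈ Finset.range (p ^ 2),
      (k : ℝ) * (((1 + (p : ℤ) * a) * k % ((p ^ 2 : ℕ) : ℤ) : ℤ) : ℝ) =
      p * (p * (p - 1) * (2 * p - 1) / 6) + (2 * p + p ^ 2) * (p * (p - 1) / 2) ^ 2 := by
    have e : ∀ j ∈ Finset.range p, ∀ r ∈ Finset.range p, ((p * j + r : ℕ) : ℝ) *
        (((1 + (p : ℤ) * a) * ((p * j + r : ℕ) : ℤ) % ((p ^ 2 : ℕ) : ℤ) : ℤ) : ℝ) =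
        (r : ℝ) ^ 2 + p * j * r + p * (r * (((a * r + j) % p : ℤ) : ℝ))
          + p ^ 2 * j * (((a * r + j) % p : ℤ) : ℝ) := by
      intro j _ r hr
      rw [hres j r (Finset.mem_range.mp hr)]
      push_cast
      ring
    rw [show Finset.range (p ^ 2) = Finset.range (p * p) by rw [sq], sum_range_mul_eq_sum_sum,
      Finset.sum_congr rfl fun j hj => Finset.sum_congr rfl (e j hj)]
    simp only [Finset.sum_add_distrib, ← Finset.mul_sum, hs1]
    -- The weight `r` depends on `r` alone, so the sum over `j` is taken first.
    have hx : ∑ j ∈ Finset.range p, ∑ r ∈ Finset.range p,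
        (r : ℝ) * (((a * r + j) % p : ℤ) : ℝ) = (p * (p - 1) / 2) ^ 2 := by
      rw [Finset.sum_comm]
      simp only [← Finset.mul_sum, hs2, ← Finset.sum_mul, sum_range_cast_real]
      ring
    rw [hx]
    simp only [← Finset.mul_sum, ← Finset.sum_mul, sum_range_cast_real, sum_range_sq_cast_real,
      Finset.sum_const, Finset.card_range, nsmul_eq_mul]
    ring
  rw [hsum] at h
  push_cast at h
  refine mul_left_cancel₀ (pow_ne_zero 2 hpr) ?_
  rw [h]
  field_simp
  ring

lemma normDedekindSum_unit_add_mul {p : ℕ} (hp : p.Prime) {ε : ℤ} (hε : ε = 1 ∨ ε = -1) {a : ℤ}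
    (ha : ¬ (p : ℤ) ∣ a) :
    normDedekindSum (ε + p * a) (p ^ 2) = ε * (2 / (p : ℝ) ^ 2 - 2) := by
  rcases hε with rfl | rfl
  · rw [normDedekindSum_one_add_mul hp ha]
    push_cast
    ring
  · have := normDedekindSum_one_add_mul hp (a := -a) (by rwa [dvd_neg])
    rw [show (-1 : ℤ) + p * a = -(1 + p * -a) by ring, normDedekindSum_neg, this]
    push_cast
    ring

lemma add_mul_modEq_sq {p : ℕ} (ε : ℤ) {a b : ℤ} (h : (p : ℤ) ∣ b - a) :
    ε + p * a ≡ ε + p * b [ZMOD (p ^ 2 : ℕ)] := by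
  obtain ⟨c, hc⟩ := h
  refine Int.modEq_of_dvd ⟨c, ?_⟩
  push_cast
  linear_combination (p : ℤ) * hc

lemma normDedekindSum_unit_add_mul_of_dvd {p : ℕ} (hp : p.Prime) {ε : ℤ} (hε : ε = 1 ∨ ε = -1)
    {a : ℤ} (ha : (p : ℤ) ∣ a) :
    normDedekindSum (ε + p * a) (p ^ 2) = ε * ((p : ℝ) ^ 2 - 3 + 2 / (p : ℝ) ^ 2) := by
  have hn : 0 < p ^ 2 := pow_pos hp.pos 2
  rw [normDedekindSum_congr hn (isCoprime_add_mul_sq hε a)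
    (add_mul_modEq_sq ε (b := 0) (by simpa using ha)), mul_zero, add_zero]
  have h1 := normDedekindSum_one hn
  rcases hε with rfl | rfl
  · rw [h1]
    push_cast
    ring
  · rw [normDedekindSum_neg, h1]
    push_cast
    ring

/-- Equality of Dedekind sums separates the residues `ε` from the other `ε + p a`. -/
lemma dvd_iff_dvd_of_normDedekindSum_eq {p : ℕ} (hp : p.Prime) {ε : ℤ} (hε : ε = 1 ∨ ε = -1)
    {a b : ℤ} (h : normDedekindSum (ε + p * a) (p ^ 2) = normDedekindSum (ε + p * b) (p ^ 2)) :
    (p : ℤ) ∣ a ↔ (p : ℤ) ∣ b := by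
  have hp2 : (2 : ℝ) ≤ p := by exact_mod_cast hp.two_le
  -- The two values differ by `ε (p² - 1)`.
  have hne : (ε : ℝ) * ((p : ℝ) ^ 2 - 3 + 2 / (p : ℝ) ^ 2) ≠ ε * (2 / (p : ℝ) ^ 2 - 2) := by
    have h0 : (ε : ℝ) ≠ 0 := by rcases hε with rfl | rfl <;> norm_num
    intro e
    have := mul_left_cancel₀ h0 e
    nlinarith
  by_cases ha : (p : ℤ) ∣ a <;> by_cases hb : (p : ℤ) ∣ b
  · exact iff_of_true ha hb
  · rw [normDedekindSum_unit_add_mul_of_dvd hp hε ha, normDedekindSum_unit_add_mul hp hε hb] at h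
    exact absurd h hne
  · rw [normDedekindSum_unit_add_mul_of_dvd hp hε hb, normDedekindSum_unit_add_mul hp hε ha] at h
    exact absurd h.symm hne
  · exact iff_of_false ha hb

/-! ### Representatives up to inversion -/

lemma exists_mem_halfSeries {p : ℕ} (hp : p.Prime) (hp2 : p ≠ 2) {ε : ℤ} (hε : ε = 1 ∨ ε = -1)
    {a : ℤ} (ha : ¬ (p : ℤ) ∣ a) : ∃ c ∈ halfSeries p ε, EqOrInverse (p ^ 2) (ε + p * a) c := by
  have hp0 : (0 : ℤ) < p := by exact_mod_cast hp.pos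
  have hodd := hp.eq_two_or_odd
  have b0 := Int.emod_nonneg a hp0.ne'
  have b1 := Int.emod_lt_of_pos a hp0
  have bne : a % p ≠ 0 := fun h => ha (Int.dvd_of_emod_eq_zero h)
  have hd := Int.emod_add_mul_ediv a p
  obtain ⟨r, hr⟩ := Int.eq_ofNat_of_zero_le b0
  rw [hr] at b1 bne hd
  by_cases h : 2 * r ≤ p - 1
  · refine ⟨_, ⟨r, by omega, h, rfl⟩, Or.inl (add_mul_modEq_sq ε ⟨-(a / p), ?_⟩)⟩
    linear_combination hd
  -- The inverse of `ε + p r` is `ε - p r ≡ ε + p (p - r)`.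
  · refine ⟨_, ⟨p - r, by omega, by omega, rfl⟩, Or.inr (Int.modEq_of_dvd ?_)⟩
    rw [Nat.cast_sub (by omega)]
    refine ⟨-ε * (1 + a / p) - a * (p - r), ?_⟩
    have : ε * ε = 1 := by rcases hε with rfl | rfl <;> rfl
    push_cast
    linear_combination (p : ℤ) * ε * hd - this

lemma EqOrInverse.modEq_or_mul_modEq_one {n : ℕ} {m₁ m₂ a : ℤ} (h₁ : EqOrInverse n m₁ a)
    (h₂ : EqOrInverse n m₂ a) : m₁ ≡ m₂ [ZMOD n] ∨ m₁ * m₂ ≡ 1 [ZMOD n] := by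
  rcases h₁ with h₁ | h₁ <;> rcases h₂ with h₂ | h₂
  · exact Or.inl (h₁.trans h₂.symm)
  · exact Or.inr ((h₁.mul_right m₂).trans (by rwa [mul_comm]))
  · exact Or.inr ((h₂.mul_left m₁).trans h₁)
  · have e1 := h₂.mul_left m₁
    have e2 := h₁.mul_right m₂
    rw [mul_one] at e1
    rw [one_mul] at e2
    refine Or.inl (e1.symm.trans (Int.ModEq.trans ?_ e2))
    rw [show m₁ * (m₂ * a) = m₁ * a * m₂ by ring]

lemma nonObviousEq_of_mem_halfSeries {p : ℕ} (hp : p.Prime) {ε : ℤ} (hε : ε = 1 ∨ ε = -1)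
    {a b : ℤ} (ha : a ∈ halfSeries p ε) (hb : b ∈ halfSeries p ε) (hab : a ≠ b) :
    NonObviousEq (p ^ 2) a b := by
  obtain ⟨x, hx1, hx2, rfl⟩ := ha
  obtain ⟨y, hy1, hy2, rfl⟩ := hb
  have hp0 : (p : ℤ) ≠ 0 := by exact_mod_cast hp.ne_zero
  have hsmall : ∀ z : ℤ, 0 < |z| → |z| < p → ¬ (p : ℤ) ∣ z := by
    intro z h0 h1 hd
    exact abs_pos.mp h0 (Int.eq_zero_of_abs_lt_dvd hd h1)
  have hxy : x ≠ y := fun h => hab (by rw [h])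
  refine ⟨?_, fun h => ?_, fun h => ?_⟩
  · rw [normDedekindSum_unit_add_mul hp hε (hsmall x (by rw [abs_pos]; omega)
        (by rw [abs_lt]; omega)),
      normDedekindSum_unit_add_mul hp hε (hsmall y (by rw [abs_pos]; omega)
        (by rw [abs_lt]; omega))]
  · obtain ⟨c, hc⟩ := h.dvd
    refine hsmall ((y : ℤ) - x) (by rw [abs_pos]; omega) (by rw [abs_lt]; omega) ⟨c, ?_⟩
    refine mul_left_cancel₀ hp0 ?_
    push_cast at hc
    linear_combination hc
  · obtain ⟨c, hc⟩ := h.dvd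
    -- The product is `1 + ε p (x + y)` mod `p²`, and `0 < x + y < p`.
    refine hsmall ((x : ℤ) + y) (by rw [abs_pos]; omega) (by rw [abs_lt]; omega)
      ⟨-ε * (c + x * y), ?_⟩
    have hεε : ε * ε = 1 := by rcases hε with rfl | rfl <;> rfl
    refine mul_left_cancel₀ hp0 ?_
    push_cast at hc
    linear_combination -ε * hc - (ε + p * (x + y : ℤ)) * hεε

theorem corollary3 (p : ℕ) (hp : p.Prime) :
    -- the common value
    (∀ ε : ℤ, ε = 1 ∨ ε = -1 → ∀ m : ℕ, 1 ≤ m → m ≤ p - 1 →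
      normDedekindSum (ε + (p : ℤ) * (m : ℤ)) (p ^ 2) = (ε : ℝ) * (2 / (p : ℝ) ^ 2 - 2)) ∧
    -- for p ≥ 5 this yields non-obvious equalities
    (5 ≤ p → ∀ ε : ℤ, ε = 1 ∨ ε = -1 →
      (halfSeries p ε).Nontrivial ∧
      ∀ a ∈ halfSeries p ε, ∀ b ∈ halfSeries p ε, a ≠ b → NonObviousEq (p ^ 2) a b) ∧
    -- every non-obvious equality arises from these by passing to inverses
    (∀ m₁ m₂ : ℤ, ¬ (p : ℤ) ∣ m₁ → ¬ (p : ℤ) ∣ m₂ → NonObviousEq (p ^ 2) m₁ m₂ →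
      5 ≤ p ∧ ∃ ε : ℤ, (ε = 1 ∨ ε = -1) ∧
        ∃ a ∈ halfSeries p ε, ∃ b ∈ halfSeries p ε, a ≠ b ∧
          EqOrInverse (p ^ 2) m₁ a ∧ EqOrInverse (p ^ 2) m₂ b) := by
  refine ⟨fun ε hε m h1 h2 => ?_, fun h5 ε hε => ⟨?_, ?_⟩, fun m₁ m₂ h₁ h₂ h => ?_⟩
  · refine normDedekindSum_unit_add_mul hp hε fun h => ?_
    have := Nat.le_of_dvd (by omega) (Int.natCast_dvd_natCast.mp h)
    omega
  · refine ⟨ε + p * (1 : ℕ), ⟨1, by omega, by omega, rfl⟩, ε + p * (2 : ℕ),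
      ⟨2, by omega, by omega, rfl⟩, ?_⟩
    push_cast
    omega
  · exact fun a ha b hb hab => nonObviousEq_of_mem_halfSeries hp hε ha hb hab
  · obtain ⟨hS, hne, hni⟩ := h
    have hP := Nat.prime_iff_prime_int.mp hp
    have hcop : ∀ z : ℤ, ¬ (p : ℤ) ∣ z → IsCoprime z ((p ^ 2 : ℕ) : ℤ) := fun z hz => by
      push_cast
      exact IsCoprime.pow_right (hP.coprime_iff_not_dvd.mpr hz).symm
    have hd := dvd_of_normDedekindSum_eq (pow_pos hp.pos 2) (hcop _ h₁) (hcop _ h₂) hS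
    -- If `p` misses one factor, `p²` divides the other and the equality is obvious.
    have hsub : (p : ℤ) ∣ m₁ - m₂ := by
      by_contra hc
      exact hni (Int.modEq_of_dvd ((hcop _ hc).symm.dvd_of_dvd_mul_left hd)).symm
    have hmul : (p : ℤ) ∣ m₁ * m₂ - 1 := by
      by_contra hc
      exact hne (Int.modEq_of_dvd ((hcop _ hc).symm.dvd_of_dvd_mul_right hd)).symm
    -- Modulo `p`, `m₁² ≡ m₁ m₂ ≡ 1`.
    obtain ⟨ε, hε, hdε⟩ : ∃ ε : ℤ, (ε = 1 ∨ ε = -1) ∧ (p : ℤ) ∣ m₁ - ε := by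
      have : (p : ℤ) ∣ (m₁ - 1) * (m₁ - -1) := by
        rw [show (m₁ - 1) * (m₁ - -1) = m₁ * m₂ - 1 + m₁ * (m₁ - m₂) by ring]
        exact hmul.add (hsub.mul_left m₁)
      rcases hP.dvd_or_dvd this with h | h
      · exact ⟨1, Or.inl rfl, h⟩
      · exact ⟨-1, Or.inr rfl, h⟩
    obtain ⟨x, hx⟩ := hdε
    obtain ⟨y, hy⟩ : (p : ℤ) ∣ m₂ - ε := by
      rw [show m₂ - ε = m₁ - ε - (m₁ - m₂) by ring]
      exact (Dvd.intro x hx.symm).sub hsub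
    obtain rfl : m₁ = ε + p * x := by linear_combination hx
    obtain rfl : m₂ = ε + p * y := by linear_combination hy
    have hiff := dvd_iff_dvd_of_normDedekindSum_eq hp hε hS
    have hx0 : ¬ (p : ℤ) ∣ x := fun h => hne (add_mul_modEq_sq ε ((hiff.mp h).sub h))
    have hy0 : ¬ (p : ℤ) ∣ y := fun h => hx0 (hiff.mpr h)
    have hp2 : p ≠ 2 := by
      -- For `p = 2`, `x` and `y` are both odd, so `m₁ ≡ m₂` mod `4`.
      rintro rfl
      refine hne (add_mul_modEq_sq ε ?_)
      push_cast at hx0 hy0 ⊢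
      omega
    obtain ⟨a, ha, hxa⟩ := exists_mem_halfSeries hp hp2 hε hx0
    obtain ⟨b, hb, hyb⟩ := exists_mem_halfSeries hp hp2 hε hy0
    have hab : a ≠ b := by
      rintro rfl
      exact (hxa.modEq_or_mul_modEq_one hyb).elim hne hni
    refine ⟨?_, ε, hε, a, ha, b, hb, hab, hxa, hyb⟩
    obtain ⟨r, hr1, hr2, rfl⟩ := ha
    obtain ⟨s, hs1, hs2, rfl⟩ := hb
    -- Two distinct integers in `1, …, (p - 1) / 2` require `p ≥ 5`.
    have : r ≠ s := fun h => hab (by rw [h])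
    omega
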